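/- Let $n\ge 2$ be an integer and $[n]=\{1,\dots,n\}$. Call a simple graph two-connected if it is connected and remains connected after the removal of any one vertex together with its incident edges (so the single edge on two vertices is two-connected), and let $\mathcal{B}[n]$ be the set of two-connected graphs with vertex set $[n]$. For a graph $G$ on $[n]$ with edge set $E(G)$ let $e(G)=|E(G)|$ and $$\Pi_G=\{(x_2,\dots,x_n)\in\mathbb{R}^{n-1} : |x_i-x_j|<1 \text{ for all } \{i,j\}\in E(G)\},\qquad\text{where } x_1=0.$$ Then $\Pi_G$ has finite volume (Lebesgue measure in $\mathbb{R}^{n-1}$) for every $G\in\mathcal{B}[n]$, and $$\sum_{G\in\mathcal{B}[n]}(-1)^{e(G)}\,\mathrm{Vol}(\Pi_G)=-n\,(n-2)!.$$ -/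

import Mathlib

open MeasureTheory

noncomputable section

namespace TonksGas

/-- A graph is two-connected if it is connected and stays connected whenever a vertex is removed
together with its incident edges. In particular the single edge on two vertices is two-connected. -/
def IsTwoConnected {V : Type*} (G : SimpleGraph V) : Prop :=
  G.Connected ∧ ∀ v : V, (G.induce {v}ᶜ).Connected

open Classical in
/-- The set of two-connected graphs on `n` labelled vertices. -/
def twoConnectedGraphs (n : ℕ) : Finset (SimpleGraph (Fin n)) :=
  Finset.univ.filter fun G => IsTwoConnected G

/-- The vertices other than the first one (which is `0` in `Fin n`); there are `n - 1` of them. -/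
abbrev FreeVertex (n : ℕ) : Type := {i : Fin n // i.val ≠ 0}

/-- The positions of all `n` vertices, when the first one is placed at the origin. -/
def position {n : ℕ} (x : FreeVertex n → ℝ) (i : Fin n) : ℝ :=
  if h : i.val ≠ 0 then x ⟨i, h⟩ else 0

/-- The polytope of `G` in `ℝ^(n-1)`: adjacent vertices are at distance less than `1`,
the first vertex being at the origin. -/
def polytope {n : ℕ} (G : SimpleGraph (Fin n)) : Set (FreeVertex n → ℝ) :=
  {x | ∀ i j : Fin n, G.Adj i j → |position x i - position x j| < 1}

end TonksGas

end


/-!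
In the unit distance graph `H` of a configuration `x` of points on the line, the neighbours of a
leftmost point are pairwise adjacent, and so it is in every subset of the points. The contribution
of `x` to the sum of volumes is the signed number of two-connected spanning subgraphs of `H`, and
this number is `-(n - 2)!` if `H` is complete and `0` otherwise. To see this, pick a vertex `v`
whose neighbours form a clique, and an edge `uv`. Two-connected graphs cancel in pairs under adding
or deleting `uv`, except for those that without `uv` are a chain of several blocks from `u` to `v`.
Cut off the last block, which is attached at `w` and contains `v`. If `uw` is an edge of `H`, adding
or deleting it cancels the remaining chains, unless the chain is `uw` itself; if not, then `w` is
not a neighbour of `v`, so the last block has a vertex set that is not a clique, and cancels by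
induction. What remains is the number of neighbours `w ≠ v` of `u` times the signed number for the
graph without `u`.

The polytope of the complete graph consists of the configurations of diameter less than `1`. It is
cut by the index of the leftmost point into `n` cells, and moving the origin to that point maps a
cell to a unit cube.
-/

namespace TonksGas

section Graphs

variable {V : Type*} {G G' H : SimpleGraph V} {A X X' : Set V} {u v w w' : V}

open SimpleGraph

-- A closed predicate in place of walks: a connectivity proof only has to choose the right `p`, and
-- what remains is a first-order case analysis.
theorem preconnected_induce_iff : (G.induce A).Preconnected ↔
    ∀ p : V → Prop, (∀ a ∈ A, ∀ b ∈ A, G.Adj a b → p a → p b) → ∀ a ∈ A, ∀ b ∈ A, p a → p b := by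
  constructor
  · intro h p hp a ha b hb
    obtain ⟨walk⟩ := h ⟨a, ha⟩ ⟨b, hb⟩
    have hwalk : ∀ {x y : A}, (G.induce A).Walk x y → p x → p y := fun walk => by
      induction walk with
      | nil => exact id
      | @cons x y _ hxy _ ih => exact fun hx => ih (hp x x.2 y y.2 hxy hx)
    exact hwalk walk
  · intro h a b
    obtain ⟨_, hab⟩ := h (fun x => ∃ hx : x ∈ A, (G.induce A).Reachable a ⟨x, hx⟩)
      (fun x _ y hy hxy ⟨hx, hax⟩ =>
        ⟨hy, hax.trans (Adj.reachable (G := G.induce A) (u := ⟨x, hx⟩) (v := ⟨y, hy⟩) hxy)⟩)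
      a a.2 b b.2 ⟨a.2, .rfl⟩
    exact hab

theorem induce_congr (h : ∀ a ∈ A, ∀ b ∈ A, G.Adj a b ↔ G'.Adj a b) :
    G.induce A = G'.induce A := by
  ext a b
  exact h a a.2 b b.2

/-- The graph induced by `G` on `A` is two-connected, where the empty graph counts as connected;
this allows `A` to have fewer than two vertices. -/
def IsTwoConnectedOn (G : SimpleGraph V) (A : Set V) : Prop :=
  (G.induce A).Preconnected ∧ ∀ c ∈ A, (G.induce (A \ {c})).Preconnected

theorem isTwoConnected_iff_isTwoConnectedOn_univ [Nontrivial V] :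
    IsTwoConnected G ↔ IsTwoConnectedOn G Set.univ := by
  have hdel (c : V) :
      (G.induce {c}ᶜ).Connected ↔ (G.induce (Set.univ \ {c})).Preconnected := by
    have : Nonempty ({c}ᶜ : Set V) := (Set.nonempty_compl_of_nontrivial c).to_subtype
    rw [connected_iff, and_iff_left this, Set.compl_eq_univ_sdiff]
  simp only [IsTwoConnected, IsTwoConnectedOn, hdel, connected_iff G, Nontrivial.to_nonempty,
    and_true, (induceUnivIso G).preconnected_iff, Set.mem_univ, true_imp_iff]

theorem IsTwoConnectedOn.mono (h : IsTwoConnectedOn G A) (hle : G ≤ G') : IsTwoConnectedOn G' A :=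
  ⟨h.1.mono (comap_monotone _ hle), fun c hc => (h.2 c hc).mono (comap_monotone _ hle)⟩

theorem isTwoConnectedOn_congr (h : ∀ a ∈ A, ∀ b ∈ A, G.Adj a b ↔ G'.Adj a b) :
    IsTwoConnectedOn G A ↔ IsTwoConnectedOn G' A := by
  rw [IsTwoConnectedOn, IsTwoConnectedOn, induce_congr h]
  exact and_congr_right fun _ => forall₂_congr fun c _ => by
    rw [induce_congr fun a ha b hb => h a ha.1 b hb.1]

theorem IsTwoConnectedOn.preconnected_of_sup_edge (h : IsTwoConnectedOn (G ⊔ edge u v) A)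
    (hu : u ∈ A) (hv : v ∈ A) (hw : w ∈ A) (hwu : w ≠ u) (hwv : w ≠ v) :
    (G.induce A).Preconnected := by
  obtain rfl | huv := eq_or_ne u v
  · simpa using h.1
  have hu' := preconnected_induce_iff.1 (h.2 u hu)
  have hv' := preconnected_induce_iff.1 (h.2 v hv)
  refine preconnected_induce_iff.2 fun p hp => ?_
  have := hu' p (by grind)
  have := hv' p (by grind)
  grind

/-- `G` induces on `A` a chain of blocks leading from `u` to `v`, which is encoded by the property
that the edge `uv` closes the chain to a two-connected graph. -/
@[grind]
structure IsBlockChain (G : SimpleGraph V) (A : Set V) (u v : V) : Prop where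
  preconnected : (G.induce A).Preconnected
  sup_edge : IsTwoConnectedOn (G ⊔ edge u v) A

theorem isBlockChain_congr (h : ∀ a ∈ A, ∀ b ∈ A, G.Adj a b ↔ G'.Adj a b) :
    IsBlockChain G A u v ↔ IsBlockChain G' A u v := by
  have hsup : ∀ a ∈ A, ∀ b ∈ A, (G ⊔ edge u v).Adj a b ↔ (G' ⊔ edge u v).Adj a b := by grind
  exact ⟨fun hG => ⟨induce_congr h ▸ hG.1, (isTwoConnectedOn_congr hsup).1 hG.2⟩,
    fun hG => ⟨induce_congr h ▸ hG.1, (isTwoConnectedOn_congr hsup).2 hG.2⟩⟩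

/-- `insert w X` and `A \ X` are two parts of `A` that share only the vertex `w`, and they separate
`v`, which lies in the first part, from `u`, which lies in the second. -/
@[grind]
structure IsSplitting (A : Set V) (u v w : V) (X : Set V) : Prop where
  subset : X ⊆ A
  cut_mem : w ∈ A
  cut_notMem : w ∉ X
  target_mem : v ∈ X
  source_mem : u ∈ A
  source_notMem : u ∉ X
  source_ne_cut : u ≠ w

/-- `w` is a cut vertex that separates in `G` the vertices of `X`, among them `v`, from the other
vertices of `A`, among them `u`. -/
@[grind]
structure IsSeparation (G : SimpleGraph V) (A : Set V) (u v w : V) (X : Set V) : Prop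
    extends IsSplitting A u v w X where
  eq_cut : ∀ a ∈ X, ∀ b ∈ A \ X, G.Adj a b → b = w

/-- `insert w X` is the last block of a chain of blocks from `u` to `v` with vertex set `A`, and
`w` is the cut vertex at which it is attached to the rest of the chain. -/
@[grind]
structure IsLastBlock (G : SimpleGraph V) (A : Set V) (u v w : V) (X : Set V) : Prop
    extends IsSeparation G A u v w X where
  block : IsTwoConnectedOn G (insert w X)
  rest : IsBlockChain G (A \ X) u w

theorem IsSeparation.not_isTwoConnectedOn (h : IsSeparation G A u v w X) :
    ¬ IsTwoConnectedOn G A := fun h₂ =>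
  h.source_notMem <| preconnected_induce_iff.1 (h₂.2 w h.cut_mem) (· ∈ X)
    (fun a _ b hb hab haX => by_contra fun hbX => hb.2 (h.eq_cut a haX b ⟨hb.1, hbX⟩ hab))
    v ⟨h.subset h.target_mem, fun e => h.cut_notMem (e ▸ h.target_mem)⟩
    u ⟨h.source_mem, h.source_ne_cut⟩ h.target_mem

-- Without `w` the block `insert w' X'` is still connected and contains `v`, so it stays inside `X`.
theorem IsLastBlock.insert_subset_insert (h : IsLastBlock G A u v w X)
    (h' : IsLastBlock G A u v w' X') : insert w' X' ⊆ insert w X := by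
  have hconn : (G.induce (insert w' X' \ {w})).Preconnected := by
    by_cases hw : w ∈ insert w' X'
    · exact h'.block.2 w hw
    · rw [Set.sdiff_singleton_eq_self hw]
      exact h'.block.1
  have := preconnected_induce_iff.1 hconn (· ∈ X) (by grind) v
  grind

theorem IsLastBlock.unique (h : IsLastBlock G A u v w X) (h' : IsLastBlock G A u v w' X') :
    w = w' ∧ X = X' := by
  have hB : insert w X = insert w' X' :=
    (h'.insert_subset_insert h).antisymm (h.insert_subset_insert h')
  have hw : w = w' := by
    by_contra hne
    have := preconnected_induce_iff.1 h.rest.preconnected (· = w) (by grind) w (by grind) u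
    grind
  grind

theorem IsLastBlock.isTwoConnectedOn_sup_edge (h : IsLastBlock G A u v w X) :
    IsTwoConnectedOn (G ⊔ edge u v) A := by
  have hvu : (G ⊔ edge u v).Adj u v := by grind
  have hB := preconnected_induce_iff.1 h.block.1
  have hR := preconnected_induce_iff.1 h.rest.preconnected
  refine ⟨preconnected_induce_iff.2 fun p hp => ?_,
    fun c hc => preconnected_induce_iff.2 fun p hp => ?_⟩
  · have := hB p (by grind)
    have := hR p (by grind)
    grind
  obtain rfl | hcw := eq_or_ne c w
  · have := preconnected_induce_iff.1 (h.block.2 c (by grind)) p (by grind)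
    have := preconnected_induce_iff.1 (h.rest.sup_edge.2 c (by grind)) p (by grind)
    have := hp u (by grind) v (by grind) hvu
    have := hp v (by grind) u (by grind) hvu.symm
    grind
  by_cases hcX : c ∈ X
  · have hpR := hR p (by grind)
    have hpX := preconnected_induce_iff.1 (h.block.2 c (by grind)) p (by grind)
    have hpw : ∀ a ∈ A \ {c}, p a ↔ p w := by grind
    grind
  · have hpB := hB p (by grind)
    have hpuw : c ≠ u → (p u ↔ p w) := fun hcu => by
      have := hp u (by grind) v (by grind) hvu
      have := hp v (by grind) u (by grind) hvu.symm
      grind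
    have hadj : ∀ a ∈ (A \ X) \ {c}, ∀ b ∈ (A \ X) \ {c},
        (G ⊔ edge u w).Adj a b → p a → p b := by
      simp only [sup_adj, edge_adj]
      grind
    have := preconnected_induce_iff.1 (h.rest.sup_edge.2 c (by grind)) p hadj
    grind

theorem exists_isSeparation (h : IsTwoConnectedOn (G ⊔ edge u v) A) (hu : u ∈ A) (hv : v ∈ A)
    (hG : (G.induce A).Preconnected) (hnot : ¬ IsTwoConnectedOn G A) :
    ∃ w X, IsSeparation G A u v w X := by
  obtain ⟨c, hc, hdis⟩ : ∃ c ∈ A, ¬ (G.induce (A \ {c})).Preconnected := by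
    simpa [IsTwoConnectedOn, hG] using hnot
  rw [preconnected_induce_iff] at hdis
  push Not at hdis
  obtain ⟨p, hp, a, ha, b, hb, hpa, hpb⟩ := hdis
  have huv : u ≠ c ∧ v ≠ c ∧ ¬ (p u ↔ p v) := by
    by_contra hcon
    exact hpb (preconnected_induce_iff.1 (h.2 c hc) p (by grind) a ha b hb hpa)
  exact ⟨c, {x ∈ A \ {c} | p x ↔ p v},
    { subset := by grind
      cut_mem := hc
      cut_notMem := by grind
      target_mem := by grind
      source_mem := hu
      source_notMem := by grind
      source_ne_cut := huv.1
      eq_cut := by grind [adj_comm] }⟩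

theorem IsSeparation.preconnected_insert (h : IsSeparation G A u v w X)
    (hG : (G.induce A).Preconnected) : (G.induce (insert w X)).Preconnected := by
  refine preconnected_induce_iff.2 fun p hp => ?_
  have := preconnected_induce_iff.1 hG (fun x => (x ∈ X ∧ p x) ∨ (x ∉ X ∧ p w))
    (by grind [adj_comm])
  grind

theorem IsSeparation.preconnected_sdiff (h : IsSeparation G A u v w X)
    (hG : (G.induce A).Preconnected) : (G.induce (A \ X)).Preconnected := by
  refine preconnected_induce_iff.2 fun p hp => ?_
  have := preconnected_induce_iff.1 hG (fun x => (x ∈ X ∧ p w) ∨ (x ∉ X ∧ p x))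
    (by grind [adj_comm])
  grind

theorem IsSeparation.isBlockChain_sdiff (h : IsSeparation G A u v w X)
    (hG : (G.induce A).Preconnected) (h₂ : IsTwoConnectedOn (G ⊔ edge u v) A) :
    IsBlockChain G (A \ X) u w := by
  have hrest := h.preconnected_sdiff hG
  refine ⟨hrest, hrest.mono (comap_monotone _ le_sup_left),
    fun c hc => preconnected_induce_iff.2 fun p hp => ?_⟩
  have hAc := preconnected_induce_iff.1 (h₂.2 c hc.1)
  obtain rfl | hcw := eq_or_ne c w
  · have := hAc (fun x => (x ∈ X ∧ p u) ∨ (x ∉ X ∧ p x)) (by grind [adj_comm])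
    grind
  · have := hAc (fun x => (x ∈ X ∧ p w) ∨ (x ∉ X ∧ p x)) (by grind [adj_comm])
    grind

theorem IsSeparation.isTwoConnectedOn_insert_of_minimal (h : IsSeparation G A u v w X)
    (hG : (G.induce A).Preconnected) (h₂ : IsTwoConnectedOn (G ⊔ edge u v) A)
    (hmin : ∀ w' X', IsSeparation G A u v w' X' → X' ⊆ X → X' = X) :
    IsTwoConnectedOn G (insert w X) := by
  refine ⟨h.preconnected_insert hG, fun c hc => preconnected_induce_iff.2 fun p hp => ?_⟩
  obtain rfl | hcw := eq_or_ne c w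
  · have hY : IsSeparation G A u v c {x ∈ X | p x ↔ p v} :=
      { subset := by grind
        cut_mem := by grind
        cut_notMem := by grind
        target_mem := by grind
        source_mem := by grind
        source_notMem := by grind
        source_ne_cut := by grind
        eq_cut := by grind [adj_comm] }
    have := hmin _ _ hY (by grind)
    grind
  · have hcX : c ∈ X := by grind
    have hY : ∀ a ∈ {x ∈ X \ {c} | ¬ (p x ↔ p w)}, ∀ b ∈ A, G.Adj a b →
        b = c ∨ b ∈ {x ∈ X \ {c} | ¬ (p x ↔ p w)} := by
      grind [adj_comm]
    by_cases hv : v ∈ X \ {c} ∧ ¬ (p v ↔ p w)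
    · have hsep : IsSeparation G A u v c {x ∈ X \ {c} | ¬ (p x ↔ p w)} :=
        { subset := by grind
          cut_mem := by grind
          cut_notMem := by grind
          target_mem := by grind
          source_mem := by grind
          source_notMem := by grind
          source_ne_cut := by grind
          eq_cut := by grind }
      have := hmin _ _ hsep (by grind)
      grind
    · have := preconnected_induce_iff.1 (h₂.2 c (by grind))
        (· ∈ {x ∈ X \ {c} | ¬ (p x ↔ p w)}) (by grind)
      grind

theorem exists_isLastBlock [Finite V] (h : IsTwoConnectedOn (G ⊔ edge u v) A) (hu : u ∈ A)
    (hv : v ∈ A) (hw : w ∈ A) (hwu : w ≠ u) (hwv : w ≠ v) (hnot : ¬ IsTwoConnectedOn G A) :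
    ∃ w X, IsLastBlock G A u v w X := by
  have hG := h.preconnected_of_sup_edge hu hv hw hwu hwv
  obtain ⟨c, X, hsep⟩ := exists_isSeparation h hu hv hG hnot
  obtain ⟨Y, ⟨d, hY⟩, hmin⟩ :=
    (Set.toFinite {X | ∃ c, IsSeparation G A u v c X}).exists_minimal ⟨X, c, hsep⟩
  refine ⟨d, Y, hY, hY.isTwoConnectedOn_insert_of_minimal hG h fun c' X' hsep' hX' => ?_,
    hY.isBlockChain_sdiff hG h⟩
  exact hX'.antisymm (hmin ⟨c', hsep'⟩ hX')

theorem preconnected_induce_pair (huv : u ≠ v) :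
    (G.induce {u, v}).Preconnected ↔ G.Adj u v := by
  refine ⟨fun h => ?_, fun h => (induce_pair_connected_of_adj h).preconnected⟩
  have := preconnected_induce_iff.1 h (· = u)
  grind [adj_comm]

theorem isTwoConnectedOn_pair (huv : u ≠ v) : IsTwoConnectedOn G {u, v} ↔ G.Adj u v := by
  rw [IsTwoConnectedOn, preconnected_induce_pair huv, and_iff_left_iff_imp]
  refine fun _ c hc => preconnected_induce_iff.2 fun p _ => ?_
  grind

theorem isBlockChain_pair (huv : u ≠ v) : IsBlockChain G {u, v} u v ↔ G.Adj u v := by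
  rw [← preconnected_induce_pair huv]
  exact ⟨fun h => h.1, fun h => ⟨h, (isTwoConnectedOn_pair huv).2 (by grind)⟩⟩

/-- The graph on all of `V` whose edges are those of `H` inside `A`. Unlike `H.induce A` it has the
same vertex type as `H`, so that such graphs for different `A` can be compared and joined. -/
def restrict (H : SimpleGraph V) (A : Set V) : SimpleGraph V where
  Adj a b := a ∈ A ∧ b ∈ A ∧ H.Adj a b
  symm := ⟨fun _ _ ⟨ha, hb, hab⟩ => ⟨hb, ha, hab.symm⟩⟩
  loopless := ⟨fun _ h => h.2.2.ne rfl⟩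

theorem restrict_adj {a b : V} : (restrict H A).Adj a b ↔ a ∈ A ∧ b ∈ A ∧ H.Adj a b :=
  .rfl

theorem le_restrict_iff :
    G ≤ restrict H A ↔ ∀ a b, G.Adj a b → a ∈ A ∧ b ∈ A ∧ H.Adj a b :=
  .rfl

theorem restrict_univ : restrict H Set.univ = H := by
  ext a b
  simp [restrict_adj]

theorem restrict_pair (huv : H.Adj u v) : restrict H {u, v} = edge u v := by
  ext a b
  grind [restrict_adj, adj_comm, Adj.ne]

theorem IsSplitting.le_and_isLastBlock_iff (h : IsSplitting A u v w X) :
    G ≤ restrict H A \ edge u v ∧ IsLastBlock G A u v w X ↔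
      G ≤ restrict H (insert w X) ⊔ restrict H (A \ X) ∧
        IsTwoConnectedOn G (insert w X) ∧ IsBlockChain G (A \ X) u w := by
  rw [le_sdiff, disjoint_edge]
  constructor
  · rintro ⟨⟨hle, -⟩, hG⟩
    refine ⟨fun a b hab => ?_, hG.block, hG.rest⟩
    grind [restrict_adj, le_restrict_iff, adj_comm]
  · rintro ⟨hle, hB, hR⟩
    have hadj : ∀ a b, G.Adj a b → (a ∈ insert w X ∧ b ∈ insert w X ∧ H.Adj a b) ∨
        (a ∈ A \ X ∧ b ∈ A \ X ∧ H.Adj a b) := hle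
    exact ⟨⟨by grind [le_restrict_iff], by grind⟩, ⟨h, by grind⟩, hB, hR⟩

theorem isClique_iff_isClique_sdiff (hv : v ∈ A) (hvu : v ≠ u)
    (hdom : ∀ w ∈ A, w ≠ u → H.Adj v w → H.Adj u w) (huv : H.Adj u v) :
    H.IsClique A ↔ H.IsClique (A \ {u}) := by
  refine ⟨fun h => h.subset Set.sdiff_subset, fun h a ha b hb hab => ?_⟩
  have hu : ∀ w ∈ A, w ≠ u → H.Adj u w := fun w hw hwu => by
    obtain rfl | hwv := eq_or_ne w v
    · exact huv
    · exact hdom w hw hwu (h ⟨hv, hvu⟩ ⟨hw, hwu⟩ hwv.symm)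
  by_cases hau : a = u
  · exact hau ▸ hu b hb (hau ▸ hab.symm)
  by_cases hbu : b = u
  · exact hbu ▸ (hu a ha hau).symm
  · exact h ⟨ha, hau⟩ ⟨hb, hbu⟩ hab

/-- A graph in which every nonempty set `A` contains a vertex whose neighbours in `A` are pairwise
adjacent; for finite graphs these are the chordal graphs. -/
def HasSimplicialVertices (H : SimpleGraph V) : Prop :=
  ∀ A : Set V, A.Nonempty → ∃ v ∈ A, H.IsClique (A ∩ H.neighborSet v)

theorem ncard_adj_of_isClique (h : H.IsClique A) (hu : u ∈ A) (hv : v ∈ A) (huv : u ≠ v) :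
    {w ∈ A | w ≠ v ∧ H.Adj u w}.ncard = A.ncard - 2 := by
  have hset : {w ∈ A | w ≠ v ∧ H.Adj u w} = A \ {u, v} := by
    ext w
    have hadj : w ∈ A → u ≠ w → H.Adj u w := fun hw => h hu hw
    grind [Adj.ne]
  rw [hset, Set.ncard_sdiff (by grind), Set.ncard_pair huv]

theorem eq_edge_iff_adj (huv : u ≠ v) (h : G ≤ edge u v) : G = edge u v ↔ G.Adj u v := by
  rw [← h.ge_iff_eq, edge_le_iff, or_iff_right huv]

/-- The sign `(-1) ^ e(G)` with which the graph `G` is counted. -/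
noncomputable def edgeSign (G : SimpleGraph V) : ℤ :=
  (-1) ^ G.edgeSet.ncard

theorem edgeSign_edge (h : u ≠ v) : edgeSign (edge u v) = -1 := by
  simp [edgeSign, edgeSet_edge_of_ne h]

theorem edgeSign_sup_of_disjoint [Finite V] (h : Disjoint G G') :
    edgeSign (G ⊔ G') = edgeSign G * edgeSign G' := by
  rw [edgeSign, edgeSet_sup, Set.ncard_union_eq (disjoint_edgeSet.2 h), pow_add, edgeSign, edgeSign]

section SignedSums

variable [Fintype V] {K L : SimpleGraph V} {P Q R : SimpleGraph V → Prop}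

open Classical in
/-- The number of subgraphs of `K` with the property `P`, each counted with its sign. -/
noncomputable def signedSum (K : SimpleGraph V) (P : SimpleGraph V → Prop) : ℤ :=
  ∑ G with G ≤ K ∧ P G, edgeSign G

theorem signedSum_eq_sum {s : Finset (SimpleGraph V)} (h : ∀ G, G ∈ s ↔ G ≤ K ∧ P G) :
    signedSum K P = ∑ G ∈ s, edgeSign G :=
  Finset.sum_congr (by grind) fun _ _ => rfl

theorem signedSum_congr (h : ∀ G, G ≤ K ∧ P G ↔ G ≤ L ∧ Q G) : signedSum K P = signedSum L Q :=
  Finset.sum_congr (by grind) fun _ _ => rfl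

theorem signedSum_eq_zero (h : ∀ G ≤ K, ¬ P G) : signedSum K P = 0 := by
  classical
  exact Finset.sum_eq_zero (by grind)

theorem signedSum_sub_of_imp (h : ∀ G, P G → Q G) :
    signedSum K Q - signedSum K P = signedSum K fun G => Q G ∧ ¬ P G := by
  classical
  simp only [signedSum, Finset.sum_filter, ← Finset.sum_sub_distrib]
  exact Finset.sum_congr rfl (by grind)

theorem signedSum_exists {ι : Type*} [Fintype ι] {P : ι → SimpleGraph V → Prop}
    (h : ∀ G i j, P i G → P j G → i = j) :
    signedSum K (fun G => ∃ i, P i G) = ∑ i, signedSum K (P i) := by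
  classical
  simp only [signedSum, Finset.sum_filter]
  rw [Finset.sum_comm]
  refine Finset.sum_congr rfl fun G _ => ?_
  rw [Finset.sum_ite_zero _ _ fun i _ j _ hi hj => h G i j hi.2 hj.2]
  simp

theorem signedSum_sup (hKL : Disjoint K L) (h : ∀ G ≤ K, ∀ G' ≤ L, P (G ⊔ G') ↔ Q G ∧ R G') :
    signedSum (K ⊔ L) P = signedSum K Q * signedSum L R := by
  classical
  have hsplit : ∀ G ≤ K ⊔ L, G ⊓ K ⊔ G ⊓ L = G := fun G hG => by
    rw [← inf_sup_left, inf_eq_left.2 hG]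
  have hleft : ∀ G ≤ K, ∀ G' ≤ L, (G ⊔ G') ⊓ K = G := fun G hG G' hG' => by
    rw [inf_sup_right, inf_eq_left.2 hG, (hKL.symm.mono_left hG').eq_bot, sup_bot_eq]
  have hright : ∀ G ≤ K, ∀ G' ≤ L, (G ⊔ G') ⊓ L = G' := fun G hG G' hG' => by
    rw [inf_sup_right, inf_eq_left.2 hG', (hKL.mono_left hG).eq_bot, bot_sup_eq]
  rw [signedSum, signedSum, signedSum, Finset.sum_mul_sum, ← Finset.sum_product']
  refine (Finset.sum_nbij' (fun G => G.1 ⊔ G.2) (fun G => (G ⊓ K, G ⊓ L)) ?_ ?_ ?_ ?_ ?_).symm <;>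
    simp only [Finset.mem_product, Finset.mem_filter_univ, and_imp, Prod.forall]
  · exact fun G G' hG hQ hG' hR => ⟨sup_le_sup hG hG', (h G hG G' hG').2 ⟨hQ, hR⟩⟩
  · exact fun G hG hP => and_and_and_comm.1
      ⟨⟨inf_le_right, inf_le_right⟩, (h _ inf_le_right _ inf_le_right).1 (by rwa [hsplit G hG])⟩
  · exact fun G G' hG _ hG' _ => Prod.ext (hleft G hG G' hG') (hright G hG G' hG')
  · exact fun G hG _ => hsplit G hG
  · exact fun G G' hG _ hG' _ => (edgeSign_sup_of_disjoint (hKL.mono hG hG')).symm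

theorem signedSum_edge_adj (huv : u ≠ v) : signedSum (edge u v) (·.Adj u v) = -1 := by
  rw [← signedSum_congr fun G => and_congr_right (eq_edge_iff_adj huv), signedSum,
    Finset.sum_eq_single_of_mem (edge u v) (by simp) (by simp +contextual), edgeSign_edge huv]

theorem signedSum_eq_sub_sup_edge (huv : u ≠ v) (hK : K.Adj u v) :
    signedSum K P =
      signedSum (K \ edge u v) P - signedSum (K \ edge u v) fun G => P (G ⊔ edge u v) := by
  have hle (G : SimpleGraph V) : G ≤ K \ edge u v ↔ G ≤ K ∧ ¬ G.Adj u v := by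
    rw [le_sdiff, disjoint_edge]
  have hnot : signedSum K (fun G => P G ∧ ¬ (P G ∧ G.Adj u v)) = signedSum (K \ edge u v) P :=
    signedSum_congr (by grind)
  have hadj : signedSum K (fun G => P G ∧ G.Adj u v) =
      -signedSum (K \ edge u v) fun G => P (G ⊔ edge u v) := by
    nth_rw 1 [← sdiff_sup_cancel ((edge_le_iff K).2 (.inr hK))]
    rw [signedSum_sup (Q := fun G => P (G ⊔ edge u v)) (R := (·.Adj u v)) disjoint_sdiff_self_left,
      signedSum_edge_adj huv, mul_neg_one]
    intro G hG G' hG'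
    have := eq_edge_iff_adj huv hG'
    grind
  rw [← sub_add_cancel (signedSum K P), signedSum_sub_of_imp fun _ => And.left, hnot, hadj,
    sub_eq_add_neg]

/-- The signed number of two-connected graphs with vertex set `A` and edges from `H`. -/
noncomputable def twoConnectedSum (H : SimpleGraph V) (A : Set V) : ℤ :=
  signedSum (restrict H A) (IsTwoConnectedOn · A)

/-- The signed number of chains of blocks from `u` to `v` with vertex set `A` and edges
from `H`. -/
noncomputable def chainSum (H : SimpleGraph V) (A : Set V) (u v : V) : ℤ :=
  signedSum (restrict H A) (IsBlockChain · A u v)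

-- Adding or deleting the edge `uv` maps block chains to block chains, which cancel in pairs.
theorem chainSum_eq_zero (hu : u ∈ A) (hv : v ∈ A) (hw : w ∈ A) (hwu : w ≠ u) (hwv : w ≠ v)
    (huv : H.Adj u v) : chainSum H A u v = 0 := by
  have hiff (G : SimpleGraph V) : IsBlockChain (G ⊔ edge u v) A u v ↔ IsBlockChain G A u v := by
    refine ⟨fun h => ?_, fun h => ⟨h.1.mono (comap_monotone _ le_sup_left), ?_⟩⟩
    · have h₂ : IsTwoConnectedOn (G ⊔ edge u v) A := by simpa [sup_assoc] using h.sup_edge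
      exact ⟨h₂.preconnected_of_sup_edge hu hv hw hwu hwv, h₂⟩
    · simpa [sup_assoc] using h.sup_edge
  rw [chainSum, signedSum_eq_sub_sup_edge huv.ne (restrict_adj.2 ⟨hu, hv, huv⟩)]
  simp only [hiff, sub_self]

theorem twoConnectedSum_pair (huv : H.Adj u v) : twoConnectedSum H {u, v} = -1 := by
  simp only [twoConnectedSum, isTwoConnectedOn_pair huv.ne, restrict_pair huv,
    signedSum_edge_adj huv.ne]

theorem chainSum_pair (huv : H.Adj u v) : chainSum H {u, v} u v = -1 := by
  simp only [chainSum, isBlockChain_pair huv.ne, restrict_pair huv,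
    signedSum_edge_adj huv.ne]

theorem twoConnectedSum_eq_zero (hu : u ∈ A) (hv : v ∈ A) (huv : u ≠ v)
    (h : ∀ w ∈ A, ¬ H.Adj v w) : twoConnectedSum H A = 0 :=
  signedSum_eq_zero fun G hG hA => by
    have := preconnected_induce_iff.1 hA.1 (· = v) (by grind [le_restrict_iff]) v hv u hu rfl
    grind

-- The graphs that stay two-connected without the edge `uv` cancel against their copies with it.
theorem twoConnectedSum_eq_neg_signedSum_exists (hu : u ∈ A) (hv : v ∈ A) (hw : w ∈ A) (hwu : w ≠ u)
    (hwv : w ≠ v) (huv : H.Adj u v) :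
    twoConnectedSum H A = -signedSum (restrict H A \ edge u v)
      fun G => ∃ p : V × Set V, IsLastBlock G A u v p.1 p.2 := by
  rw [twoConnectedSum, signedSum_eq_sub_sup_edge huv.ne (restrict_adj.2 ⟨hu, hv, huv⟩),
    ← neg_sub, signedSum_sub_of_imp fun G h => h.mono le_sup_left]
  congr 2 with G
  constructor
  · rintro ⟨h, hnot⟩
    obtain ⟨w, X, hX⟩ := exists_isLastBlock h hu hv hw hwu hwv hnot
    exact ⟨(w, X), hX⟩
  · rintro ⟨p, hp⟩
    exact ⟨hp.isTwoConnectedOn_sup_edge, hp.not_isTwoConnectedOn⟩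

theorem signedSum_isLastBlock (h : IsSplitting A u v w X) :
    signedSum (restrict H A \ edge u v) (IsLastBlock · A u v w X) =
      twoConnectedSum H (insert w X) * chainSum H (A \ X) u w := by
  classical
  have hdisj : Disjoint (restrict H (insert w X)) (restrict H (A \ X)) := by
    rw [disjoint_left]
    grind [restrict_adj, Adj.ne]
  have hfilter : signedSum (restrict H A \ edge u v) (IsLastBlock · A u v w X) =
      signedSum (restrict H (insert w X) ⊔ restrict H (A \ X))
        fun G => IsTwoConnectedOn G (insert w X) ∧ IsBlockChain G (A \ X) u w :=
    signedSum_congr fun G => h.le_and_isLastBlock_iff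
  rw [hfilter, signedSum_sup hdisj, twoConnectedSum, chainSum]
  intro G hG G' hG'
  have hB : ∀ a ∈ insert w X, ∀ b ∈ insert w X, (G ⊔ G').Adj a b ↔ G.Adj a b := by
    grind [le_restrict_iff, Adj.ne]
  have hR : ∀ a ∈ A \ X, ∀ b ∈ A \ X, (G ⊔ G').Adj a b ↔ G'.Adj a b := by
    grind [le_restrict_iff, Adj.ne]
  exact and_congr (isTwoConnectedOn_congr hB) (isBlockChain_congr hR)

open Classical in
theorem twoConnectedSum_eq_neg_sum (hu : u ∈ A) (hv : v ∈ A) (hw : w ∈ A) (hwu : w ≠ u)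
    (hwv : w ≠ v) (huv : H.Adj u v) :
    twoConnectedSum H A = -∑ p : V × Set V with IsSplitting A u v p.1 p.2,
      twoConnectedSum H (insert p.1 p.2) * chainSum H (A \ p.2) u p.1 := by
  rw [twoConnectedSum_eq_neg_signedSum_exists hu hv hw hwu hwv huv,
    signedSum_exists fun G p q hp hq => Prod.ext_iff.2 (hp.unique hq), Finset.sum_filter]
  refine congrArg _ (Finset.sum_congr rfl fun p _ => ?_)
  split_ifs with h
  · exact signedSum_isLastBlock h
  · exact signedSum_eq_zero fun _ _ hG => h hG.toIsSplitting

theorem IsSplitting.twoConnectedSum_mul_chainSum_eq_zero (h : IsSplitting A u v w X)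
    (huv : H.Adj u v) (hdom : ∀ w ∈ A, w ≠ u → H.Adj v w → H.Adj u w)
    (hzero : ∀ B ⊂ A, ¬ H.IsClique B → twoConnectedSum H B = 0)
    (hne : ¬ (H.Adj u w ∧ X = A \ {u, w})) :
    twoConnectedSum H (insert w X) * chainSum H (A \ X) u w = 0 := by
  by_cases huw : H.Adj u w
  · obtain ⟨x, hx, hxu, hxw⟩ : ∃ x ∈ A \ X, x ≠ u ∧ x ≠ w := by
      by_contra! hcon
      exact hne ⟨huw, by ext x; have := hcon x; grind⟩
    rw [chainSum_eq_zero (by grind) (by grind) hx hxu hxw huw, mul_zero]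
  · have hwv : w ≠ v := by grind
    have hnot : ¬ H.IsClique (insert w X) := fun hcl =>
      huw (hdom w h.cut_mem h.source_ne_cut.symm (hcl (by grind) (by grind) hwv.symm))
    have hss : insert w X ⊂ A := by
      rw [Set.ssubset_iff_exists]
      exact ⟨by grind, u, by grind⟩
    rw [hzero _ hss hnot, zero_mul]

-- In the sum over the splittings of `A` only those with `A \ X = {u, w}` contribute: otherwise `w`
-- is adjacent to `u`, and the chain sum vanishes, or it is not, and `insert w X` is not a clique.
theorem twoConnectedSum_eq_mul (hu : u ∈ A) (hv : v ∈ A) (hA : 3 ≤ A.ncard) (huv : H.Adj u v)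
    (hdom : ∀ w ∈ A, w ≠ u → H.Adj v w → H.Adj u w)
    (hzero : ∀ B ⊂ A, ¬ H.IsClique B → twoConnectedSum H B = 0) :
    twoConnectedSum H A = {w ∈ A | w ≠ v ∧ H.Adj u w}.ncard * twoConnectedSum H (A \ {u}) := by
  classical
  obtain ⟨x, hx, hxuv⟩ : ∃ x ∈ A, x ∉ ({u, v} : Set V) :=
    Set.exists_mem_notMem_of_ncard_lt_ncard ((Set.ncard_pair huv.ne).trans_lt hA)
  simp only [Set.mem_insert_iff, Set.mem_singleton_iff, not_or] at hxuv
  rw [twoConnectedSum_eq_neg_sum hu hv hx hxuv.1 hxuv.2 huv, neg_eq_iff_eq_neg, ← mul_neg,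
    Set.ncard_eq_toFinset_card', ← nsmul_eq_mul, ← Finset.sum_const]
  symm
  refine Finset.sum_of_injOn (fun w => (w, A \ {u, w})) (fun _ _ _ _ h => congrArg Prod.fst h)
    ?_ ?_ ?_
  · intro w hw
    rw [Set.coe_toFinset] at hw
    rw [Finset.mem_coe, Finset.mem_filter_univ]
    constructor <;> grind [huv.ne, hw.2.2.ne]
  · intro p hp hnot
    have hp' : IsSplitting A u v p.1 p.2 := (Finset.mem_filter.1 hp).2
    refine hp'.twoConnectedSum_mul_chainSum_eq_zero huv hdom hzero fun h => ?_
    exact hnot ⟨p.1, by grind, Prod.ext rfl h.2.symm⟩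
  · intro w hw
    rw [Set.mem_toFinset] at hw
    have hB : insert w (A \ {u, w}) = A \ {u} := by grind [hw.2.2.ne]
    have hR : A \ (A \ {u, w}) = {u, w} := by grind
    simp only [hB, hR, chainSum_pair hw.2.2, mul_neg_one]

open Classical in
theorem twoConnectedSum_eq_ite (hH : HasSimplicialVertices H) (hA : 2 ≤ A.ncard) :
    twoConnectedSum H A = if H.IsClique A then -((A.ncard - 2).factorial : ℤ) else 0 := by
  induction hn : A.ncard using Nat.strong_induction_on generalizing A with
  | h n ih =>
    have hzero : ∀ B ⊂ A, ¬ H.IsClique B → twoConnectedSum H B = 0 := fun B hBA hB => by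
      have hB₂ : 2 ≤ B.ncard := by
        refine Set.one_lt_ncard_iff_nontrivial.2 ?_
        contrapose! hB
        exact hB.pairwise _
      rw [ih _ (hn ▸ Set.ncard_lt_ncard hBA) hB₂ rfl, if_neg hB]
    obtain ⟨v, hv, hsimp⟩ := hH A (Set.nonempty_of_ncard_ne_zero (by lia))
    by_cases hiso : ∀ w ∈ A, ¬ H.Adj v w
    · obtain ⟨u, hu, huv⟩ := Set.exists_ne_of_one_lt_ncard hA v
      rw [twoConnectedSum_eq_zero hu hv huv hiso, if_neg]
      exact fun hcl => hiso u hu (hcl hv hu huv.symm)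
    push Not at hiso
    obtain ⟨u, hu, hvu⟩ := hiso
    have hdom : ∀ w ∈ A, w ≠ u → H.Adj v w → H.Adj u w := fun w hw hwu hvw =>
      hsimp ⟨hu, hvu⟩ ⟨hw, hvw⟩ hwu.symm
    obtain hA₂ | hA₃ := hA.eq_or_lt
    · obtain rfl : {u, v} = A := Set.eq_of_subset_of_ncard_le (by grind)
        (by rw [← hA₂, Set.ncard_pair hvu.ne'])
      rw [twoConnectedSum_pair hvu.symm, if_pos (isClique_pair.2 fun _ => hvu.symm), ← hn, ← hA₂]
      rfl
    have hcard : (A \ {u}).ncard = n - 1 := by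
      rw [Set.ncard_sdiff_singleton_of_mem hu, hn]
    rw [twoConnectedSum_eq_mul hu hv hA₃ hvu.symm hdom hzero,
      ih (n - 1) (by lia) (by lia) hcard, ← isClique_iff_isClique_sdiff hv hvu.ne hdom hvu.symm]
    split_ifs with hcl
    · obtain ⟨m, rfl⟩ : ∃ m, n = m + 3 := ⟨n - 3, by lia⟩
      rw [ncard_adj_of_isClique hcl hu hv hvu.ne', hn]
      simp [Nat.factorial_succ]
    · exact mul_zero _

end SignedSums
end Graphs

/-- The graph of the pairs of points at distance less than `1`. -/
def unitDistanceGraph {V : Type*} (p : V → ℝ) : SimpleGraph V where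
  Adj i j := i ≠ j ∧ |p i - p j| < 1
  symm := ⟨fun i j h => ⟨h.1.symm, by rw [abs_sub_comm]; exact h.2⟩⟩
  loopless := ⟨fun _ h => h.1 rfl⟩

theorem hasSimplicialVertices_unitDistanceGraph {V : Type*} [Finite V] (p : V → ℝ) :
    HasSimplicialVertices (unitDistanceGraph p) := by
  intro A hA
  obtain ⟨v, hv, hmin⟩ := Set.exists_min_image A p A.toFinite hA
  refine ⟨v, hv, fun a ⟨ha, hva⟩ b ⟨hb, hvb⟩ hab => ⟨hab, ?_⟩⟩
  have hva' := abs_lt.1 hva.2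
  have hvb' := abs_lt.1 hvb.2
  rw [abs_lt]
  constructor <;> linarith [hmin a ha, hmin b hb]

section Polytopes

variable {n : ℕ} {G : SimpleGraph (Fin n)} {x : FreeVertex n → ℝ}

theorem mem_twoConnectedGraphs : G ∈ twoConnectedGraphs n ↔ IsTwoConnected G := by
  classical
  exact Finset.mem_filter_univ G

theorem mem_polytope_iff : x ∈ polytope G ↔ G ≤ unitDistanceGraph (position x) :=
  ⟨fun h i j hij => ⟨hij.ne, h i j hij⟩, fun h _ _ hij => (h hij).2⟩

theorem mem_polytope_top_iff :
    x ∈ polytope (⊤ : SimpleGraph (Fin n)) ↔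
      (unitDistanceGraph (position x)).IsClique Set.univ := by
  rw [mem_polytope_iff, top_le_iff, SimpleGraph.isClique_univ]

open Classical in
theorem sum_edgeSign_eq_twoConnectedSum [Nontrivial (Fin n)] (x : FreeVertex n → ℝ) :
    ∑ G ∈ twoConnectedGraphs n with x ∈ polytope G, edgeSign G =
      twoConnectedSum (unitDistanceGraph (position x)) Set.univ := by
  rw [twoConnectedSum, restrict_univ]
  refine (signedSum_eq_sum fun G => ?_).symm
  rw [Finset.mem_filter, mem_twoConnectedGraphs, mem_polytope_iff,
    isTwoConnected_iff_isTwoConnectedOn_univ, and_comm]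

theorem sum_indicator_polytope (hn : 2 ≤ n) (x : FreeVertex n → ℝ) :
    ∑ G ∈ twoConnectedGraphs n,
      (polytope G).indicator (fun _ => (-1 : ℝ) ^ G.edgeSet.ncard) x =
    (polytope (⊤ : SimpleGraph (Fin n))).indicator (fun _ => -((n - 2).factorial : ℝ)) x := by
  classical
  have : Nontrivial (Fin n) := Fin.nontrivial_iff_two_le.2 hn
  have hsum := (sum_edgeSign_eq_twoConnectedSum x).trans <|
    twoConnectedSum_eq_ite (hasSimplicialVertices_unitDistanceGraph (position x))
      (by simpa [Set.ncard_univ] using hn)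
  rw [Set.ncard_univ, Nat.card_fin, Finset.sum_filter] at hsum
  simp only [Set.indicator_apply, mem_polytope_top_iff]
  exact_mod_cast hsum

theorem continuous_position (i : Fin n) :
    Continuous fun x : FreeVertex n → ℝ => position x i := by
  unfold position
  split_ifs <;> fun_prop

theorem isOpen_polytope (G : SimpleGraph (Fin n)) : IsOpen (polytope G) := by
  simp only [polytope, Set.ofPred_forall]
  exact isOpen_iInter_of_finite fun i => isOpen_iInter_of_finite fun j =>
    isOpen_iInter_of_finite fun _ =>
      isOpen_lt ((continuous_position i).sub (continuous_position j)).abs continuous_const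

theorem abs_position_le_length (hx : x ∈ polytope G) {i j : Fin n} (p : G.Walk i j) :
    |position x i - position x j| ≤ p.length := by
  induction p with
  | nil => simp
  | @cons i k j hik p ih =>
    have hik' := hx i k hik
    have htri := abs_sub_le (position x i) (position x k) (position x j)
    rw [SimpleGraph.Walk.length_cons, Nat.cast_succ]
    linarith

theorem volume_polytope_ne_top (hG : G.Connected) : volume (polytope G) ≠ ⊤ := by
  have hsub : polytope G ⊆ Set.pi Set.univ fun j : FreeVertex n =>
      Metric.closedBall 0 (G.dist j ⟨0, j.1.pos⟩) := by
    intro x hx j _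
    obtain ⟨p, hp⟩ := hG.exists_walk_length_eq_dist j ⟨0, j.1.pos⟩
    have := abs_position_le_length hx p
    simpa [hp, position, j.2] using this
  exact measure_ne_top_of_subset hsub
    (isCompact_univ_pi fun _ => isCompact_closedBall _ _).measure_lt_top.ne

/-- The vertex other than `k` whose position relative to `k` is the coordinate `j` after moving
the origin to `k`. -/
def recentreVertex (k : Fin n) (j : FreeVertex n) : Fin n :=
  if j.1 = k then ⟨0, k.pos⟩ else j.1

theorem range_recentreVertex (k : Fin n) : Set.range (recentreVertex k) = {k}ᶜ := by
  ext i
  rw [Set.mem_compl_singleton_iff, Set.mem_range]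
  constructor
  · rintro ⟨j, rfl⟩
    have := j.2
    grind [recentreVertex]
  · intro hik
    by_cases hi : i.val = 0
    · exact ⟨⟨k, by grind⟩, by grind [recentreVertex]⟩
    · exact ⟨⟨i, hi⟩, if_neg hik⟩

/-- The linear map that moves the origin to the vertex `k`, which then changes places with the
first vertex. -/
def recentre (k : Fin n) : (FreeVertex n → ℝ) →ₗ[ℝ] (FreeVertex n → ℝ) where
  toFun x j := position x (recentreVertex k j) - position x k
  map_add' x y := by
    ext j
    simp only [position, Pi.add_apply]
    split_ifs <;> ring
  map_smul' c x := by
    ext j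
    simp only [position, Pi.smul_apply, smul_eq_mul, RingHom.id_apply]
    split_ifs <;> ring

theorem recentre_apply (k : Fin n) (x : FreeVertex n → ℝ) (j : FreeVertex n) :
    recentre k x j = position x (recentreVertex k j) - position x k :=
  rfl

theorem position_recentre_self (k : Fin n) (x : FreeVertex n → ℝ) :
    position (recentre k x) k = -position x k := by
  by_cases hk : k.val = 0 <;> simp [position, hk, recentre_apply, recentreVertex]

theorem recentre_comp_recentre (k : Fin n) : recentre k ∘ₗ recentre k = LinearMap.id := by
  refine LinearMap.ext fun x => funext fun j => ?_
  rw [LinearMap.comp_apply, recentre_apply, position_recentre_self, LinearMap.id_apply]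
  have hj := j.2
  by_cases hjk : j.1 = k
  · subst hjk
    simp [recentreVertex, position, hj]
  · simp [recentreVertex, position, hj, recentre_apply, hjk]

theorem abs_det_recentre (k : Fin n) : |LinearMap.det (recentre k)| = 1 := by
  have h := congrArg LinearMap.det (recentre_comp_recentre k)
  rw [LinearMap.det_comp, LinearMap.det_id, ← sq] at h
  exact (abs_eq zero_le_one).2 (sq_eq_one_iff.1 h)

/-- The configurations of diameter less than `1` whose leftmost vertex is `k`, the smallest
index among several leftmost ones. -/
def leftmostCell (k : Fin n) : Set (FreeVertex n → ℝ) :=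
  {x | ∀ i, i ≠ k → position x i - position x k ∈
    if i < k then Set.Ioo (0 : ℝ) 1 else Set.Ico (0 : ℝ) 1}

theorem leftmostCell_eq_preimage (k : Fin n) :
    leftmostCell k = recentre k ⁻¹' Set.univ.pi fun j =>
      if recentreVertex k j < k then Set.Ioo (0 : ℝ) 1 else Set.Ico (0 : ℝ) 1 := by
  ext x
  simp only [leftmostCell, ← Set.mem_compl_singleton_iff, ← range_recentreVertex,
    Set.forall_mem_range, Set.mem_ofPred_eq, Set.mem_preimage, Set.mem_univ_pi, recentre_apply]

theorem volume_leftmostCell (k : Fin n) : volume (leftmostCell k) = 1 := by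
  have hdet : LinearMap.det (recentre k) ≠ 0 := by
    rw [← abs_ne_zero, abs_det_recentre]
    exact one_ne_zero
  rw [leftmostCell_eq_preimage, Measure.addHaar_preimage_linearMap _ hdet, abs_inv,
    abs_det_recentre, volume_pi_pi, Finset.prod_eq_one]
  · simp
  · intro j _
    split_ifs <;> simp

theorem measurableSet_leftmostCell (k : Fin n) : MeasurableSet (leftmostCell k) := by
  rw [leftmostCell_eq_preimage]
  refine (recentre k).continuous_of_finiteDimensional.measurable
    (MeasurableSet.univ_pi fun j => ?_)
  split_ifs
  · exact measurableSet_Ioo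
  · exact measurableSet_Ico

theorem exists_mem_leftmostCell [NeZero n] (hx : x ∈ polytope (⊤ : SimpleGraph (Fin n))) :
    ∃ k, x ∈ leftmostCell k := by
  obtain ⟨k, hk⟩ := Finite.exists_min fun i : Fin n => toLex (position x i, i)
  refine ⟨k, fun i hi => ?_⟩
  have hlt := (abs_lt.1 (hx i k hi)).2
  have hle := hk i
  rw [Prod.Lex.toLex_le_toLex] at hle
  split_ifs with hik <;> grind

theorem leftmostCell_subset_polytope (k : Fin n) : leftmostCell k ⊆ polytope ⊤ := by
  intro x hx i j _
  have h (i : Fin n) : position x i - position x k ∈ Set.Ico (0 : ℝ) 1 := by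
    by_cases hi : i = k
    · simp [hi]
    · have := hx i hi
      split_ifs at this
      · exact Set.Ioo_subset_Ico_self this
      · exact this
  have hi := h i
  have hj := h j
  rw [abs_lt]
  constructor <;> linarith [hi.1, hi.2, hj.1, hj.2]

theorem pairwise_disjoint_leftmostCell (n : ℕ) :
    Pairwise (Function.onFun Disjoint (leftmostCell (n := n))) := by
  refine (pairwise_disjoint_on _).2 fun k l hkl => Set.disjoint_left.2 fun x hk hl => ?_
  have hlt := hl k hkl.ne
  have hle := hk l hkl.ne'
  rw [if_pos hkl] at hlt
  rw [if_neg hkl.not_gt] at hle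
  linarith [hlt.1, hle.1]

theorem volume_polytope_top [NeZero n] : volume (polytope (⊤ : SimpleGraph (Fin n))) = n := by
  have hcells : polytope (⊤ : SimpleGraph (Fin n)) = ⋃ k, leftmostCell k :=
    subset_antisymm (fun _ hx => Set.mem_iUnion.2 (exists_mem_leftmostCell hx))
      (Set.iUnion_subset leftmostCell_subset_polytope)
  rw [hcells, measure_iUnion (pairwise_disjoint_leftmostCell n) measurableSet_leftmostCell,
    tsum_fintype]
  simp [volume_leftmostCell]

theorem integral_indicator_polytope (G : SimpleGraph (Fin n)) (c : ℝ) :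
    ∫ x, (polytope G).indicator (fun _ => c) x = c * (volume (polytope G)).toReal := by
  rw [integral_indicator_const _ (isOpen_polytope G).measurableSet, smul_eq_mul, mul_comm,
    Measure.real]

end Polytopes

end TonksGas

theorem theorem2 (n : ℕ) (hn : 2 ≤ n) :
    (∀ G ∈ TonksGas.twoConnectedGraphs n,
      MeasureTheory.volume (TonksGas.polytope G) ≠ ⊤) ∧
    ∑ G ∈ TonksGas.twoConnectedGraphs n,
      (-1 : ℝ) ^ G.edgeSet.ncard * (MeasureTheory.volume (TonksGas.polytope G)).toReal
      = -((n : ℝ) * (Nat.factorial (n - 2) : ℝ)) := by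
  have hfin : ∀ G ∈ TonksGas.twoConnectedGraphs n, volume (TonksGas.polytope G) ≠ ⊤ :=
    fun G hG => TonksGas.volume_polytope_ne_top (TonksGas.mem_twoConnectedGraphs.1 hG).1
  have hint : ∀ G ∈ TonksGas.twoConnectedGraphs n, Integrable
      ((TonksGas.polytope G).indicator fun _ => (-1 : ℝ) ^ G.edgeSet.ncard) := fun G hG =>
    (integrable_indicator_iff (TonksGas.isOpen_polytope G).measurableSet).2
      (integrableOn_const (hfin G hG))
  have : NeZero n := ⟨by lia⟩
  refine ⟨hfin, ?_⟩
  simp_rw [← TonksGas.integral_indicator_polytope]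
  rw [← integral_finsetSum _ hint]
  simp_rw [TonksGas.sum_indicator_polytope hn]
  rw [TonksGas.integral_indicator_polytope, TonksGas.volume_polytope_top, ENNReal.toReal_natCast,
    neg_mul, mul_comm]
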